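/- **Setting.** Let $N\ge 1$ be the number of actions and $T$ the number of rounds. An oblivious adversary fixes, before the game, losses $l_{i,t}\in\mathbb{R}$ and lower bounds $\lambda_{i,t}\le l_{i,t}$ for $1\le i\le N$, $1\le t\le T$. Write $s_{i,t}=l_{i,t}-\lambda_{i,t}$ for the slacks, $\mathbf{s}_t=(s_{1,t},\dots,s_{N,t})$, $d(\boldsymbol\lambda_t)=\max_i\lambda_{i,t}-\min_i\lambda_{i,t}$, and $q(\boldsymbol\lambda_{1:T})=\sum_{t=1}^T d(\boldsymbol\lambda_t)^2$. All logarithms are natural. **Algorithm Exp3.LB.P** with parameters $\eta,\beta$: put $\widetilde L_{i,0}=0$ for all $i$. In round $t=1,\dots,T$ draw $I_t$ from $\mathbf{p}_t$, where $p_{i,t}=e^{-\eta\widetilde L_{i,t-1}}/\sum_{k=1}^N e^{-\eta\widetilde L_{k,t-1}}$ (so $\mathbf p_1$ is uniform), put $$x_{i,t}=\frac{\beta s_{i,t}(1-p_{i,t})}{p_{i,t}(1-\beta s_{i,t})+\beta s_{i,t}(1-p_{i,t})},\qquad \widetilde l_{i,t}=\frac{s_{i,t}(1-x_{i,t})\,\mathbf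 1\{I_t=i\}}{p_{i,t}}+\lambda_{i,t},$$ and update $\widetilde L_{i,t}=\widetilde L_{i,t-1}+\widetilde l_{i,t}$. (In the degenerate case $N=1$, the parameter $\eta$ below is $0$, and $x_{i,t}$ is read as $0$ if its denominator vanishes.) The regret is $R_T=\sum_{t=1}^T l_{I_t,t}-\min_{k}\sum_{t=1}^T l_{k,t}$. **Theorem.** There is a universal constant $C>0$ such that the following holds for all $N\ge1$, all $T$ and all $0<\delta<1$. Let $\mathcal Q>0$ satisfy $$\tfrac12\, q(\boldsymbol\lambda_{1:T})+2\sum_{t=1}^T\|\mathbf s_t\|_2^2+4\sum_{t=1}^T \max_i\{s_{i,t}\}\, d(\boldsymbol\lambda_t)\le\mathcal Q ,$$ and run Exp3.LB.P with $\eta=\sqrt{\frac{4}{\mathcal Q}\log N}$. 1. If $\beta=\sqrt{\frac{2}{\mathcal Q}\log\frac{N+3}{\delta}}$ and $\beta s_{i,t}\le 1$ for all $i,t$, then with probability at least $1-\delta$, $R_T\le C\sqrt{\mathcal Q\log(N/\delta)}$. 2. If $\beta=\sqrt{2/\mathcal Q}$, then with probability at least $1-\delta$, $R_T\le C\sqrt{\mathcal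 Q}\,\log(N/\delta)$. 3. If $0\le\lambda_{i,t}\le l_{i,t}\le 1$ for all $i,t$, $\mathcal Q\ge 2T$, and $\beta=\min\bigl\{1,\sqrt{\tfrac{2}{\mathcal Q}\log\tfrac{N+3}{\delta}}\bigr\}$, then with probability at least $1-\delta$, $R_T\le C\sqrt{\mathcal Q\log(N/\delta)}$. Moreover, let $T\ge 1$ and $l_{i,t}\in[0,1]$ for all $i,t$. In the bandit setting ($\lambda_{i,t}=0$ for all $i,t$), Exp3.LB.P with the $\eta$ and $\beta$ of part 3 for $\mathcal Q=2NT$ satisfies $R_T\le C\sqrt{NT\log(N/\delta)}$ with probability at least $1-\delta$. In the full-information setting ($\lambda_{i,t}=l_{i,t}$ for all $i,t$), Exp3.LB.P with the $\eta$ and $\beta$ of part 3 for $\mathcal Q=2T$ satisfies $R_T\le C\sqrt{T\log(N/\delta)}$ with probability at least $1-\delta$. -/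

import Mathlib

/-- `d(x) = max_i x_i - min_i x_i`. -/
noncomputable def spread {N : ℕ} [NeZero N] (x : Fin N → ℝ) : ℝ :=
  Finset.univ.sup' Finset.univ_nonempty x - Finset.univ.inf' Finset.univ_nonempty x

/-- `(1/2) q(λ_{1:T}) + 2 ∑_t ‖s_t‖² + 4 ∑_t max_i s_{i,t} · d(λ_t)`, with slacks
`s_{i,t} = l_{i,t} - λ_{i,t}` and `q(λ_{1:T}) = ∑_t d(λ_t)²`. Rounds are indexed `0, …, T-1`. -/
noncomputable def lbVariation {N : ℕ} [NeZero N] (T : ℕ) (l lam : ℕ → Fin N → ℝ) : ℝ :=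
  1 / 2 * ∑ t ∈ Finset.range T, spread (lam t) ^ 2
    + 2 * ∑ t ∈ Finset.range T, ∑ i, (l t i - lam t i) ^ 2
    + 4 * ∑ t ∈ Finset.range T,
        Finset.univ.sup' Finset.univ_nonempty (fun i => l t i - lam t i) * spread (lam t)

/-- Exponential weights: `p_i = exp(-η L_i) / ∑_k exp(-η L_k)`. -/
noncomputable def expWeights {N : ℕ} (η : ℝ) (L : Fin N → ℝ) (i : Fin N) : ℝ :=
  Real.exp (-η * L i) / ∑ k, Real.exp (-η * L k)

theorem sum_ofReal_expWeights {N : ℕ} [NeZero N] (η : ℝ) (L : Fin N → ℝ) :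
    ∑ i, ENNReal.ofReal (expWeights η L i) = 1 := by
  have hpos : 0 < ∑ k, Real.exp (-η * L k) :=
    Finset.sum_pos (fun k _ => Real.exp_pos _) Finset.univ_nonempty
  have hnn : ∀ i ∈ Finset.univ, 0 ≤ expWeights η L i :=
    fun i _ => div_nonneg (Real.exp_pos _).le hpos.le
  rw [← ENNReal.ofReal_sum_of_nonneg hnn]
  simp only [expWeights]
  rw [← Finset.sum_div, div_self hpos.ne', ENNReal.ofReal_one]

/-- The exponential weights as a probability distribution on the actions. -/
noncomputable def expWeightsPMF {N : ℕ} [NeZero N] (η : ℝ) (L : Fin N → ℝ) : PMF (Fin N) :=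
  PMF.ofFintype (fun i => ENNReal.ofReal (expWeights η L i)) (sum_ofReal_expWeights η L)

/-- The correction factor `x` for slack `s` and probability `p`. -/
noncomputable def correctionFactor (β s p : ℝ) : ℝ :=
  β * s * (1 - p) / (p * (1 - β * s) + β * s * (1 - p))

namespace Exp3LBP

/-- The estimated cumulative losses of Exp3.LB.P with parameters `η, β` after `t` rounds in which
the actions `h 0, …, h (t-1)` were drawn. -/
noncomputable def estCumLoss {N : ℕ} (η β : ℝ) (l lam : ℕ → Fin N → ℝ) :
    (t : ℕ) → (Fin t → Fin N) → Fin N → ℝ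
  | 0, _, _ => 0
  | t + 1, h, i =>
    let prev : Fin N → ℝ := estCumLoss η β l lam t (Fin.init h)
    let p : ℝ := expWeights η prev i
    let s : ℝ := l t i - lam t i
    prev i + ((if h (Fin.last t) = i then s * (1 - correctionFactor β s p) / p else 0) + lam t i)

/-- The law of the first `t` actions drawn by Exp3.LB.P: given the actions `h` of the first `t`
rounds, the next action is drawn from the exponential weights of the estimated cumulative losses
(for `t = 0` this is the uniform distribution). -/
noncomputable def law {N : ℕ} [NeZero N] (η β : ℝ) (l lam : ℕ → Fin N → ℝ) :
    (t : ℕ) → PMF (Fin t → Fin N)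
  | 0 => PMF.pure Fin.elim0
  | t + 1 => (law η β l lam t).bind fun h =>
      (expWeightsPMF η (estCumLoss η β l lam t h)).map fun a =>
        Fin.snoc (α := fun _ => Fin N) h a

end Exp3LBP

/-- The regret `∑_t l_{I_t,t} - min_k ∑_t l_{k,t}` of the sequence of actions `h`. -/
noncomputable def regret {N : ℕ} [NeZero N] (T : ℕ) (l : ℕ → Fin N → ℝ) (h : Fin T → Fin N) : ℝ :=
  ∑ t : Fin T, l t (h t)
    - Finset.univ.inf' Finset.univ_nonempty fun k => ∑ t ∈ Finset.range T, l t k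

/-- With probability at least `1 - δ`, the regret of Exp3.LB.P with parameters `η, β` after `T`
rounds is at most `B`. -/
def Exp3LBP.RegretBound {N : ℕ} [NeZero N] (η β : ℝ) (T : ℕ) (l lam : ℕ → Fin N → ℝ)
    (δ B : ℝ) : Prop :=
  ENNReal.ofReal (1 - δ) ≤ (Exp3LBP.law η β l lam T).toMeasure {h | regret T l h ≤ B}

/-!
Write `γ = β s` for an action with slack `s` and probability `p`. The correction factor `x` is chosen
such that the slack estimate is `s (1 - γ) / (p (1 - γ) + γ (1 - p))` when the action is drawn. This
has two consequences, which hold whenever `0 ≤ γ ≤ 1`.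

* The estimate never exceeds `1 / β` (`mul_slack_div_le_one`), and therefore
  `exp (β (estimate - s))` has conditional expectation at most `1`
  (`one_sub_add_mul_exp_slack_le`). By Markov's inequality for the resulting supermartingale, no
  action has its cumulative loss overestimated by more than `log (2 N / δ) / β`, up to
  probability `δ / 2`.
* The estimate is biased downwards, but the bias `p x s` is at most `β s ^ 2`
  (`mul_correctionFactor_le`).

On every sequence of actions, the analysis of exponential weights applied to the losses shifted by
`min_i λ_i` (`round_bound`) bounds the regret by the accumulated `excess`, a deterministic
second-order term of order `η Q`, the term `log N / η` and the overestimation of the best action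
(`regret_le`). The excess of a round has conditional mean at most `(β + η) ‖s‖²` and absolute value
at most `d(λ) + max_i s_i (1 + η / β)`. The squares of these ranges sum to at most
`4 (1 + η / β) ^ 2 Q`, so a Hoeffding-type estimate (`sum_mul_exp_le`) controls the sum, up to
probability `δ / 2`. Exploiting the range of the second-order term round by round, and not only
its uniform bound `1 / β ^ 2`, is what keeps the bound for `β = √(2 / Q)` at the order
`√Q log (N / δ)`.

For `N ≥ 2` and every `β` with `β s ≤ 1` this gives the regret bound
`12 log (N / δ) / β + 11 √(Q log (N / δ)) + β Q / 2` (`regretBound_of_two_le`), from which all cases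
follow by inserting `β`. For `N = 1` the regret vanishes.
-/

namespace Exp3LBP

/-! ### Exponential inequalities -/

lemma exp_le_one_add_add_sq {x : ℝ} (hx : |x| ≤ 1) : Real.exp x ≤ 1 + x + x ^ 2 := by
  have := (abs_le.1 (Real.abs_exp_sub_one_sub_id_le hx)).2
  linarith

lemma exp_le_self_add_exp_sq (x : ℝ) : Real.exp x ≤ x + Real.exp (x ^ 2) := by
  have h2 := Real.add_one_le_exp (x ^ 2)
  rcases le_or_gt |x| 1 with hx | hx
  · linarith [exp_le_one_add_add_sq hx]
  · rcases lt_abs.1 hx with h | h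
    · have : Real.exp x ≤ Real.exp (x ^ 2) := Real.exp_le_exp.2 (by nlinarith)
      linarith
    · have : Real.exp x ≤ 1 := Real.exp_le_one_iff.2 (by linarith)
      nlinarith

lemma exp_neg_le_one_sub_add_sq {x : ℝ} (hx : 0 ≤ x) : Real.exp (-x) ≤ 1 - x + x ^ 2 := by
  rcases le_or_gt x 1 with h | h
  · have := exp_le_one_add_add_sq (x := -x) (by rw [abs_neg, abs_of_nonneg hx]; exact h)
    nlinarith
  · have : Real.exp (-x) ≤ 1 := Real.exp_le_one_iff.2 (by linarith)
    nlinarith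

/-- A one-sided Hoeffding-type bound: no centring is needed, since `exp x ≤ x + exp (x ^ 2)`. -/
lemma sum_mul_exp_le {ι : Type*} [Fintype ι] {p f : ι → ℝ} {c m M : ℝ} (hp : ∀ i, 0 ≤ p i)
    (hsum : ∑ i, p i = 1) (hc : 0 ≤ c) (hm : 0 ≤ m) (hmean : ∑ i, p i * f i ≤ m)
    (hM : ∀ i, |f i| ≤ M) :
    ∑ i, p i * Real.exp (c * f i - (c * m + c ^ 2 * M ^ 2)) ≤ 1 := by
  have key : ∑ i, p i * Real.exp (c * f i) ≤ Real.exp (c * m + c ^ 2 * M ^ 2) := by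
    calc ∑ i, p i * Real.exp (c * f i)
        ≤ ∑ i, (c * (p i * f i) + p i * Real.exp (c ^ 2 * M ^ 2)) := by
          refine Finset.sum_le_sum fun i _ => ?_
          have h1 := exp_le_self_add_exp_sq (c * f i)
          have h2 : Real.exp ((c * f i) ^ 2) ≤ Real.exp (c ^ 2 * M ^ 2) := by
            rw [Real.exp_le_exp, mul_pow]
            exact mul_le_mul_of_nonneg_left (sq_le_sq' (by linarith [(abs_le.1 (hM i)).1])
              (abs_le.1 (hM i)).2) (sq_nonneg c)
          calc p i * Real.exp (c * f i) ≤ p i * (c * f i + Real.exp (c ^ 2 * M ^ 2)) :=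
                mul_le_mul_of_nonneg_left (by linarith) (hp i)
            _ = _ := by ring
      _ = c * ∑ i, p i * f i + Real.exp (c ^ 2 * M ^ 2) := by
          rw [Finset.sum_add_distrib, ← Finset.mul_sum, ← Finset.sum_mul, hsum, one_mul]
      _ ≤ c * m * Real.exp (c ^ 2 * M ^ 2) + Real.exp (c ^ 2 * M ^ 2) := by
          have h1 : 1 ≤ Real.exp (c ^ 2 * M ^ 2) := Real.one_le_exp (by positivity)
          have h2 := mul_le_mul_of_nonneg_left hmean hc
          have h3 := le_mul_of_one_le_right (mul_nonneg hc hm) h1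
          linarith
      _ = (c * m + 1) * Real.exp (c ^ 2 * M ^ 2) := by ring
      _ ≤ Real.exp (c * m) * Real.exp (c ^ 2 * M ^ 2) :=
          mul_le_mul_of_nonneg_right (Real.add_one_le_exp _) (Real.exp_pos _).le
      _ = _ := (Real.exp_add _ _).symm
  simp only [Real.exp_sub, ← mul_div_assoc]
  rw [← Finset.sum_div]
  exact (div_le_one (Real.exp_pos _)).2 key

/-! ### The correction factor -/

section Correction

variable {β s p : ℝ}

lemma correction_denom_pos (hs : 0 ≤ β * s) (hs1 : β * s ≤ 1) (hp : 0 < p) (hp1 : p < 1) :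
    0 < p * (1 - β * s) + β * s * (1 - p) := by
  rcases hs1.lt_or_eq with h | h
  · have := mul_pos hp (sub_pos.2 h)
    have := mul_nonneg hs (sub_pos.2 hp1).le
    linarith
  · rw [h]; linarith

lemma correctionFactor_nonneg (hs : 0 ≤ β * s) (hs1 : β * s ≤ 1) (hp : 0 < p) (hp1 : p < 1) :
    0 ≤ correctionFactor β s p :=
  div_nonneg (mul_nonneg hs (sub_pos.2 hp1).le) (correction_denom_pos hs hs1 hp hp1).le

lemma correctionFactor_le_one (hs : 0 ≤ β * s) (hs1 : β * s ≤ 1) (hp : 0 < p) (hp1 : p < 1) :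
    correctionFactor β s p ≤ 1 := by
  refine (div_le_one (correction_denom_pos hs hs1 hp hp1)).2 ?_
  have := mul_nonneg hp.le (sub_nonneg.2 hs1)
  linarith

/-- The bias `p x` of the slack estimate, relative to the slack, is at most `β s`. -/
lemma mul_correctionFactor_le (hs : 0 ≤ β * s) (hs1 : β * s ≤ 1) (hp : 0 < p) (hp1 : p < 1) :
    p * correctionFactor β s p ≤ β * s := by
  have hD := correction_denom_pos hs hs1 hp hp1
  rw [correctionFactor, ← mul_div_assoc, div_le_iff₀ hD]
  -- `p (1 - γ) + γ (1 - p) - p (1 - p) = γ (1 - p)² + (1 - γ) p²` with `γ = β s`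
  have h : 0 ≤ β * s * (β * s * (1 - p) ^ 2 + (1 - β * s) * p ^ 2) :=
    mul_nonneg hs (add_nonneg (mul_nonneg hs (sq_nonneg _))
      (mul_nonneg (sub_nonneg.2 hs1) (sq_nonneg _)))
  nlinarith

lemma slack_div_eq (hs : 0 ≤ β * s) (hs1 : β * s ≤ 1) (hp : 0 < p) (hp1 : p < 1) :
    s * (1 - correctionFactor β s p) / p
      = s * (1 - β * s) / (p * (1 - β * s) + β * s * (1 - p)) := by
  have hD := correction_denom_pos hs hs1 hp hp1
  rw [correctionFactor, one_sub_div hD.ne', add_sub_cancel_right]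
  field_simp

/-- The corrected importance-weighted slack is at most `1 / β`. -/
lemma mul_slack_div_le_one (hs : 0 ≤ β * s) (hs1 : β * s ≤ 1) (hp : 0 < p) (hp1 : p < 1) :
    β * (s * (1 - correctionFactor β s p) / p) ≤ 1 := by
  have hD := correction_denom_pos hs hs1 hp hp1
  rw [slack_div_eq hs hs1 hp hp1, ← mul_div_assoc, div_le_one hD]
  -- `p (1 - γ) + γ (1 - p) - γ (1 - γ) = (1 - p) γ² + p (1 - γ)²` with `γ = β s`
  have h1 := mul_nonneg (sub_pos.2 hp1).le (sq_nonneg (β * s))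
  have h2 := mul_nonneg hp.le (sq_nonneg (1 - β * s))
  nlinarith

/-- The correction makes the exponential moment of the slack estimate at most that of the slack:
the variance term of a Bernoulli variable with parameter `p` is paid for by the factor `x`. -/
lemma one_sub_add_mul_exp_slack_le (hs : 0 ≤ β * s) (hs1 : β * s ≤ 1) (hp : 0 < p)
    (hp1 : p < 1) :
    1 - p + p * Real.exp (β * (s * (1 - correctionFactor β s p) / p)) ≤ Real.exp (β * s) := by
  have hD := correction_denom_pos hs hs1 hp hp1
  have hw1 := mul_slack_div_le_one hs hs1 hp hp1
  rw [slack_div_eq hs hs1 hp hp1] at hw1 ⊢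
  rw [← mul_div_assoc, ← mul_assoc] at hw1 ⊢
  generalize β * s = g at *
  set D := p * (1 - g) + g * (1 - p) with hDdef
  set w := g * (1 - g) / D with hw
  have hg1 : 0 ≤ 1 - g := sub_nonneg.2 hs1
  have hq : 0 < 1 - p := sub_pos.2 hp1
  have hw0 : 0 ≤ w := div_nonneg (mul_nonneg hs hg1) hD.le
  have hwD : w * D = g * (1 - g) := div_mul_cancel₀ _ hD.ne'
  have h1 : Real.exp (w * (1 - p)) ≤ 1 + w * (1 - p) + (w * (1 - p)) ^ 2 :=
    exp_le_one_add_add_sq (by rw [abs_of_nonneg (by positivity)]; nlinarith)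
  have h2 : Real.exp (w * -p) ≤ 1 + w * -p + (w * -p) ^ 2 :=
    exp_le_one_add_add_sq (by rw [mul_neg, abs_neg, abs_of_nonneg (by positivity)]; nlinarith)
  -- centred Bernoulli variable: linear terms cancel and the variance is `w ^ 2 p (1 - p)`
  have h3 : (1 - p) * Real.exp (w * -p) + p * Real.exp (w * (1 - p))
      ≤ Real.exp (w ^ 2 * (p * (1 - p))) := by
    have := Real.add_one_le_exp (w ^ 2 * (p * (1 - p)))
    have := mul_le_mul_of_nonneg_left h1 hp.le
    have := mul_le_mul_of_nonneg_left h2 hq.le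
    nlinarith
  have h4 : w * p + w ^ 2 * (p * (1 - p)) ≤ g := by
    have hpw : p * (1 - g) ≤ D := by rw [hDdef]; linarith [mul_nonneg hs hq.le]
    have hpg : p * (1 - g) * (1 - g) ≤ D :=
      (mul_le_of_le_one_right (mul_nonneg hp.le hg1) (by linarith)).trans hpw
    -- multiplied by `D`, the claim reads `g p (1 - g) + g p (1 - g) w (1 - p) ≤ g D`
    have h5 : p * (1 - g) * w ≤ g := by
      rw [hw, ← mul_div_assoc, div_le_iff₀ hD]
      nlinarith [mul_le_mul_of_nonneg_left hpg hs]
    refine le_of_mul_le_mul_right ?_ hD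
    have h6 : (w * p + w ^ 2 * (p * (1 - p))) * D
        = (w * D) * p + (w * D) * (w * (p * (1 - p))) := by ring
    have h7 := mul_le_mul_of_nonneg_left h5 (mul_nonneg hs hq.le)
    rw [h6, hwD]
    nlinarith
  calc 1 - p + p * Real.exp w
      = Real.exp (w * p) * ((1 - p) * Real.exp (w * -p) + p * Real.exp (w * (1 - p))) := by
        have e1 : Real.exp (w * p) * Real.exp (w * -p) = 1 := by
          rw [← Real.exp_add, ← Real.exp_zero]; congr 1; ring
        have e2 : Real.exp (w * p) * Real.exp (w * (1 - p)) = Real.exp w := by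
          rw [← Real.exp_add]; congr 1; ring
        linear_combination -(1 - p) * e1 - p * e2
    _ ≤ Real.exp (w * p) * Real.exp (w ^ 2 * (p * (1 - p))) :=
        mul_le_mul_of_nonneg_left h3 (Real.exp_pos _).le
    _ ≤ Real.exp g := by rw [← Real.exp_add]; exact Real.exp_le_exp.2 h4

end Correction

/-! ### The law of the play and exponential supermartingales -/

section Law

variable {N : ℕ}

/-- The sum over the first `t` rounds of a quantity `g` that depends on the round, the actions
drawn before it and the action drawn in it. -/
noncomputable def accum (g : (t : ℕ) → (Fin t → Fin N) → Fin N → ℝ) :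
    (t : ℕ) → (Fin t → Fin N) → ℝ
  | 0, _ => 0
  | t + 1, h => accum g t (Fin.init h) + g t (Fin.init h) (h (Fin.last t))

lemma accum_sub_sum (g : (t : ℕ) → (Fin t → Fin N) → Fin N → ℝ) (b : ℕ → ℝ) (t : ℕ)
    (h : Fin t → Fin N) :
    accum (fun t h a => g t h a - b t) t h = accum g t h - ∑ j ∈ Finset.range t, b j := by
  induction t with
  | zero => simp [accum]
  | succ t ih => rw [accum, accum, ih, Finset.sum_range_succ]; ring

lemma accum_const_mul (g : (t : ℕ) → (Fin t → Fin N) → Fin N → ℝ) (c : ℝ) (t : ℕ)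
    (h : Fin t → Fin N) :
    accum (fun t h a => c * g t h a) t h = c * accum g t h := by
  induction t with
  | zero => simp [accum]
  | succ t ih => rw [accum, accum, ih]; ring

variable [NeZero N]

lemma sum_exp_pos (η : ℝ) (L : Fin N → ℝ) : 0 < ∑ k, Real.exp (-η * L k) :=
  Finset.sum_pos (fun _ _ => Real.exp_pos _) Finset.univ_nonempty

lemma expWeights_pos (η : ℝ) (L : Fin N → ℝ) (i : Fin N) : 0 < expWeights η L i :=
  div_pos (Real.exp_pos _) (sum_exp_pos η L)

lemma sum_expWeights (η : ℝ) (L : Fin N → ℝ) : ∑ i, expWeights η L i = 1 := by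
  simp only [expWeights]
  rw [← Finset.sum_div, div_self (sum_exp_pos η L).ne']

lemma expWeights_lt_one (hN : 2 ≤ N) (η : ℝ) (L : Fin N → ℝ) (i : Fin N) :
    expWeights η L i < 1 := by
  have : Nontrivial (Fin N) := Fin.nontrivial_iff_two_le.2 hN
  obtain ⟨j, hj⟩ := exists_ne i
  rw [← sum_expWeights η L]
  exact Finset.single_lt_sum hj (Finset.mem_univ i) (Finset.mem_univ j) (expWeights_pos η L j)
    fun k _ _ => (expWeights_pos η L k).le

lemma law_succ_snoc (η β : ℝ) (l lam : ℕ → Fin N → ℝ) (t : ℕ) (h : Fin t → Fin N) (a : Fin N) :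
    (law η β l lam (t + 1) (Fin.snoc (α := fun _ => Fin N) h a)).toReal
      = (law η β l lam t h).toReal * expWeights η (estCumLoss η β l lam t h) a := by
  rw [law, PMF.bind_apply, tsum_fintype, Finset.sum_eq_single h]
  · rw [PMF.map_apply, tsum_fintype, Finset.sum_eq_single a]
    · rw [if_pos rfl, ENNReal.toReal_mul, expWeightsPMF, PMF.ofFintype_apply,
        ENNReal.toReal_ofReal (expWeights_pos _ _ _).le]
    · intro b _ hb
      exact if_neg fun he => hb (Fin.snoc_inj.1 he).2.symm
    · simp
  · intro g _ hg
    rw [PMF.map_apply, tsum_fintype, Finset.sum_eq_zero, mul_zero]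
    intro b _
    exact if_neg fun he => hg (Fin.snoc_inj.1 he).1.symm
  · simp

/-- If the conditional exponential moments of the increments are at most `1`, then so is the
exponential moment of the sum. -/
lemma sum_law_mul_exp_accum_le_one (η β : ℝ) (l lam : ℕ → Fin N → ℝ)
    (g : (t : ℕ) → (Fin t → Fin N) → Fin N → ℝ) (T : ℕ)
    (hg : ∀ t < T, ∀ h : Fin t → Fin N,
      ∑ a, expWeights η (estCumLoss η β l lam t h) a * Real.exp (g t h a) ≤ 1) :
    ∑ h, (law η β l lam T h).toReal * Real.exp (accum g T h) ≤ 1 := by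
  induction T with
  | zero => simp [law, accum, Subsingleton.elim _ (Fin.elim0 : Fin 0 → Fin N)]
  | succ t ih =>
    rw [← (Fin.snocEquiv fun _ => Fin N).sum_comp, Fintype.sum_prod_type_right]
    refine le_trans (Finset.sum_le_sum fun h _ => ?_) (ih fun j hj => hg j (hj.trans t.lt_succ_self))
    have hstep : ∀ a, (law η β l lam (t + 1) (Fin.snoc (α := fun _ => Fin N) h a)).toReal
        * Real.exp (accum g (t + 1) (Fin.snoc (α := fun _ => Fin N) h a))
        = (law η β l lam t h).toReal * Real.exp (accum g t h)
          * (expWeights η (estCumLoss η β l lam t h) a * Real.exp (g t h a)) := by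
      intro a
      rw [law_succ_snoc, accum, Fin.init_snoc, Fin.snoc_last, Real.exp_add]
      ring
    calc _ = ∑ a, (law η β l lam t h).toReal * Real.exp (accum g t h)
          * (expWeights η (estCumLoss η β l lam t h) a * Real.exp (g t h a)) :=
          Finset.sum_congr rfl fun a _ => hstep a
      _ ≤ _ := by
          rw [← Finset.mul_sum]
          exact mul_le_of_le_one_right (by positivity) (hg t t.lt_succ_self h)

/-- Markov's inequality for the exponential of the sum. -/
lemma law_log_lt_accum_le (η β : ℝ) (l lam : ℕ → Fin N → ℝ)
    (g : (t : ℕ) → (Fin t → Fin N) → Fin N → ℝ) (T : ℕ)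
    (hg : ∀ t < T, ∀ h : Fin t → Fin N,
      ∑ a, expWeights η (estCumLoss η β l lam t h) a * Real.exp (g t h a) ≤ 1)
    {ε : ℝ} (hε : 0 < ε) :
    (law η β l lam T).toMeasure {h | Real.log (1 / ε) < accum g T h} ≤ ENNReal.ofReal ε := by
  classical
  rw [PMF.toMeasure_apply_fintype]
  have hfin : ∀ h, law η β l lam T h ≠ ⊤ := fun h => PMF.apply_ne_top _ h
  calc _ ≤ ∑ h, ENNReal.ofReal (ε * ((law η β l lam T h).toReal * Real.exp (accum g T h))) := by
        refine Finset.sum_le_sum fun h _ => ?_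
        by_cases hh : Real.log (1 / ε) < accum g T h
        · rw [Set.indicator_of_mem (by exact hh), ← ENNReal.ofReal_toReal (hfin h)]
          refine ENNReal.ofReal_le_ofReal ?_
          rw [ENNReal.toReal_ofReal ENNReal.toReal_nonneg]
          have h1 : 1 / ε < Real.exp (accum g T h) := by
            rwa [← Real.log_lt_iff_lt_exp (by positivity)]
          have h2 : 1 ≤ ε * Real.exp (accum g T h) := by
            rw [div_lt_iff₀ hε] at h1; linarith
          calc (law η β l lam T h).toReal
              ≤ (law η β l lam T h).toReal * (ε * Real.exp (accum g T h)) :=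
                le_mul_of_one_le_right ENNReal.toReal_nonneg h2
            _ = _ := by ring
        · rw [Set.indicator_of_notMem (by exact hh)]
          exact zero_le
    _ = ENNReal.ofReal (ε * ∑ h, (law η β l lam T h).toReal * Real.exp (accum g T h)) := by
        rw [← ENNReal.ofReal_sum_of_nonneg (fun h _ => by positivity), Finset.mul_sum]
    _ ≤ ENNReal.ofReal ε := ENNReal.ofReal_le_ofReal
        (mul_le_of_le_one_right hε.le (sum_law_mul_exp_accum_le_one η β l lam g T hg))

/-- The union bound for finitely many sums of this kind. -/
lemma one_sub_le_law_of_accum {ι : Type*} [Fintype ι] (η β : ℝ) (l lam : ℕ → Fin N → ℝ) (T : ℕ)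
    (g : ι → (t : ℕ) → (Fin t → Fin N) → Fin N → ℝ) (ε : ι → ℝ) (hε : ∀ j, 0 < ε j)
    (hg : ∀ j, ∀ t < T, ∀ h : Fin t → Fin N,
      ∑ a, expWeights η (estCumLoss η β l lam t h) a * Real.exp (g j t h a) ≤ 1)
    (S : Set (Fin T → Fin N))
    (hS : ∀ h, (∀ j, accum (g j) T h ≤ Real.log (1 / ε j)) → h ∈ S) :
    ENNReal.ofReal (1 - ∑ j, ε j) ≤ (law η β l lam T).toMeasure S := by
  have hc : (law η β l lam T).toMeasure Sᶜ ≤ ENNReal.ofReal (∑ j, ε j) := by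
    calc _ ≤ (law η β l lam T).toMeasure
          (⋃ j, {h | Real.log (1 / ε j) < accum (g j) T h}) := by
          refine MeasureTheory.measure_mono fun h hh => ?_
          by_contra hcon
          simp only [Set.mem_iUnion, Set.mem_ofPred_eq, not_exists, not_lt] at hcon
          exact hh (hS h hcon)
      _ ≤ ∑ j, (law η β l lam T).toMeasure {h | Real.log (1 / ε j) < accum (g j) T h} :=
          MeasureTheory.measure_iUnion_fintype_le _ _
      _ ≤ ∑ j, ENNReal.ofReal (ε j) := Finset.sum_le_sum fun j _ =>
          law_log_lt_accum_le η β l lam (g j) T (hg j) (hε j)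
      _ = _ := (ENNReal.ofReal_sum_of_nonneg fun j _ => (hε j).le).symm
  have h1 : 1 ≤ (law η β l lam T).toMeasure S + (law η β l lam T).toMeasure Sᶜ := by
    rw [MeasureTheory.measure_add_measure_compl S.toFinite.measurableSet,
      MeasureTheory.measure_univ]
  rw [ENNReal.ofReal_sub _ (Finset.sum_nonneg fun j _ => (hε j).le), ENNReal.ofReal_one,
    tsub_le_iff_right]
  exact h1.trans (add_le_add_right hc _)

lemma regretBound_of_forall {η β : ℝ} {T : ℕ} {l lam : ℕ → Fin N → ℝ} {δ B : ℝ} (hδ : 0 < δ)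
    (h : ∀ h, regret T l h ≤ B) : RegretBound η β T l lam δ B := by
  rw [RegretBound, Set.eq_univ_of_forall (s := {g | regret T l g ≤ B}) h,
    MeasureTheory.measure_univ]
  exact ENNReal.ofReal_le_one.2 (by linarith)

lemma RegretBound.mono {η β : ℝ} {T : ℕ} {l lam : ℕ → Fin N → ℝ} {δ B B' : ℝ}
    (h : RegretBound η β T l lam δ B) (hB : B ≤ B') : RegretBound η β T l lam δ B' :=
  h.trans (MeasureTheory.measure_mono fun _ hg => le_trans hg hB)

end Law

/-! ### A single round -/

section Round

variable {ι : Type*} [Fintype ι] [DecidableEq ι] {β η : ℝ} {s lam p : ι → ℝ}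

/-- The estimate of the slack of action `i` if the action `a` is drawn. -/
noncomputable def slackEstimate (β : ℝ) (s p : ι → ℝ) (a i : ι) : ℝ :=
  if a = i then s i * (1 - correctionFactor β (s i) (p i)) / p i else 0

/-- The stochastic part of the regret of a round in which the action `a` is drawn: the loss of `a`
minus the average estimated loss, plus `η` times the part of the second-order term of the
exponential weights that depends on the slack estimate only. -/
noncomputable def excess (β η : ℝ) (s lam p : ι → ℝ) (a : ι) : ℝ :=
  lam a - ∑ i, p i * lam i + s a * correctionFactor β (s a) (p a)
    + η * (s a * slackEstimate β s p a a)

omit [Fintype ι] in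
lemma slackEstimate_nonneg (hβ : 0 < β) (hs : ∀ i, 0 ≤ s i) (hβs : ∀ i, β * s i ≤ 1)
    (hp : ∀ i, 0 < p i) (hp1 : ∀ i, p i < 1) (a i : ι) : 0 ≤ slackEstimate β s p a i := by
  rw [slackEstimate]
  split_ifs
  · have := correctionFactor_le_one (mul_nonneg hβ.le (hs i)) (hβs i) (hp i) (hp1 i)
    exact div_nonneg (mul_nonneg (hs i) (by linarith)) (hp i).le
  · exact le_rfl

omit [Fintype ι] in
lemma slackEstimate_self_le (hβ : 0 < β) (hs : ∀ i, 0 ≤ s i) (hβs : ∀ i, β * s i ≤ 1)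
    (hp : ∀ i, 0 < p i) (hp1 : ∀ i, p i < 1) (a : ι) : slackEstimate β s p a a ≤ 1 / β := by
  rw [slackEstimate, if_pos rfl, le_div_iff₀ hβ, mul_comm]
  exact mul_slack_div_le_one (mul_nonneg hβ.le (hs a)) (hβs a) (hp a) (hp1 a)

omit [Fintype ι] in
lemma mul_slackEstimate_self (hp : ∀ i, 0 < p i) (a : ι) :
    p a * slackEstimate β s p a a = s a * (1 - correctionFactor β (s a) (p a)) := by
  rw [slackEstimate, if_pos rfl, mul_div_cancel₀ _ (hp a).ne']

lemma sum_mul_slackEstimate (a : ι) :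
    ∑ i, p i * slackEstimate β s p a i = p a * slackEstimate β s p a a := by
  refine Finset.sum_eq_single a (fun i _ hi => ?_) (by simp)
  rw [slackEstimate, if_neg hi.symm, mul_zero]

lemma sum_mul_exp_slackEstimate_le_one (hβ : 0 < β) (hs : ∀ i, 0 ≤ s i)
    (hβs : ∀ i, β * s i ≤ 1) (hp : ∀ i, 0 < p i) (hp1 : ∀ i, p i < 1) (hsum : ∑ i, p i = 1)
    (k : ι) :
    ∑ a, p a * Real.exp (β * (slackEstimate β s p a k - s k)) ≤ 1 := by
  have key := one_sub_add_mul_exp_slack_le (mul_nonneg hβ.le (hs k)) (hβs k) (hp k) (hp1 k)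
  set w := s k * (1 - correctionFactor β (s k) (p k)) / p k with hw
  have h1 : ∀ a, p a * Real.exp (β * (slackEstimate β s p a k - s k))
      = (p a + if a = k then p k * (Real.exp (β * w) - 1) else 0) / Real.exp (β * s k) := by
    intro a
    rw [mul_sub, Real.exp_sub, slackEstimate, ← mul_div_assoc]
    split_ifs with h
    · rw [h, ← hw]; ring
    · simp
  rw [Finset.sum_congr rfl fun a _ => h1 a, ← Finset.sum_div, div_le_one (Real.exp_pos _),
    Finset.sum_add_distrib, hsum, Finset.sum_ite_eq' Finset.univ k, if_pos (Finset.mem_univ k)]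
  linarith

lemma sum_mul_excess_le (hβ : 0 < β) (hη : 0 ≤ η) (hs : ∀ i, 0 ≤ s i) (hβs : ∀ i, β * s i ≤ 1)
    (hp : ∀ i, 0 < p i) (hp1 : ∀ i, p i < 1) (hsum : ∑ i, p i = 1) :
    ∑ a, p a * excess β η s lam p a ≤ (β + η) * ∑ i, s i ^ 2 := by
  have h1 : ∀ a, p a * excess β η s lam p a
      ≤ p a * lam a - p a * ∑ i, p i * lam i + (β + η) * s a ^ 2 := by
    intro a
    have hb := mul_nonneg hβ.le (hs a)
    have hx0 := correctionFactor_nonneg hb (hβs a) (hp a) (hp1 a)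
    have hx := mul_le_mul_of_nonneg_left
      (mul_correctionFactor_le hb (hβs a) (hp a) (hp1 a)) (hs a)
    have hy : η * s a * (p a * slackEstimate β s p a a) ≤ η * s a * s a := by
      rw [mul_slackEstimate_self hp]
      exact mul_le_mul_of_nonneg_left (mul_le_of_le_one_right (hs a) (by linarith))
        (mul_nonneg hη (hs a))
    rw [excess]
    nlinarith
  refine (Finset.sum_le_sum fun a _ => h1 a).trans ?_
  rw [Finset.sum_add_distrib, Finset.sum_sub_distrib, ← Finset.sum_mul, hsum, ← Finset.mul_sum]
  linarith

lemma abs_excess_le (hβ : 0 < β) (hη : 0 ≤ η) (hs : ∀ i, 0 ≤ s i) (hβs : ∀ i, β * s i ≤ 1)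
    (hp : ∀ i, 0 < p i) (hp1 : ∀ i, p i < 1) (hsum : ∑ i, p i = 1) {d m : ℝ}
    (hd : ∀ i j, lam i - lam j ≤ d) (hm : ∀ i, s i ≤ m) (a : ι) :
    |excess β η s lam p a| ≤ d + m * (1 + η / β) := by
  have hb := mul_nonneg hβ.le (hs a)
  have hx0 := mul_nonneg (hs a) (correctionFactor_nonneg hb (hβs a) (hp a) (hp1 a))
  have hx1 := mul_le_mul_of_nonneg_left (correctionFactor_le_one hb (hβs a) (hp a) (hp1 a)) (hs a)
  have hy0 := mul_nonneg hη (mul_nonneg (hs a) (slackEstimate_nonneg hβ hs hβs hp hp1 a a))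
  have hy1 : η * (s a * slackEstimate β s p a a) ≤ η * (m * (1 / β)) :=
    mul_le_mul_of_nonneg_left (mul_le_mul (hm a) (slackEstimate_self_le hβ hs hβs hp hp1 a)
      (slackEstimate_nonneg hβ hs hβs hp hp1 a a) ((hs a).trans (hm a))) hη
  have hmean : lam a - ∑ i, p i * lam i = ∑ i, p i * (lam a - lam i) := by
    simp only [mul_sub]
    rw [Finset.sum_sub_distrib, ← Finset.sum_mul, hsum, one_mul]
  have hup : ∑ i, p i * (lam a - lam i) ≤ d := by
    calc _ ≤ ∑ i, p i * d := Finset.sum_le_sum fun i _ =>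
            mul_le_mul_of_nonneg_left (hd a i) (hp i).le
      _ = d := by rw [← Finset.sum_mul, hsum, one_mul]
  have hlo : -d ≤ ∑ i, p i * (lam a - lam i) := by
    calc -d = ∑ i, p i * -d := by rw [← Finset.sum_mul, hsum, one_mul]
      _ ≤ _ := Finset.sum_le_sum fun i _ =>
            mul_le_mul_of_nonneg_left (by linarith [hd i a]) (hp i).le
  have e : m * (1 + η / β) = m + η * (m * (1 / β)) := by ring
  rw [excess, hmean, e, abs_le]
  have := hm a
  constructor <;> linarith

/-- The second moment of the estimated losses, shifted by a lower bound `μ` of `lam`. Only the drawn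
action has a nonzero slack estimate, so the cross term is at most `2 m d`, whatever the action. -/
lemma sum_mul_sq_le (hβ : 0 < β) (hs : ∀ i, 0 ≤ s i) (hβs : ∀ i, β * s i ≤ 1)
    (hp : ∀ i, 0 < p i) (hp1 : ∀ i, p i < 1) (hsum : ∑ i, p i = 1) {d m μ : ℝ}
    (hμ : ∀ i, μ ≤ lam i) (hd : ∀ i, lam i - μ ≤ d) (hm : ∀ i, s i ≤ m) (a : ι) :
    ∑ i, p i * (slackEstimate β s p a i + lam i - μ) ^ 2
      ≤ d ^ 2 + 2 * (m * d) + s a * slackEstimate β s p a a := by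
  have hest := slackEstimate_nonneg hβ hs hβs hp hp1 a a
  have hd0 : 0 ≤ d := (sub_nonneg.2 (hμ a)).trans (hd a)
  have h1 : ∀ i, p i * (slackEstimate β s p a i + lam i - μ) ^ 2
      ≤ p i * d ^ 2 + p i * slackEstimate β s p a i * (slackEstimate β s p a a + 2 * d) := by
    intro i
    have h0 := sub_nonneg.2 (hμ i)
    have hsq : (lam i - μ) ^ 2 ≤ d ^ 2 := pow_le_pow_left₀ h0 (hd i) 2
    rw [mul_assoc, ← mul_add]
    refine mul_le_mul_of_nonneg_left ?_ (hp i).le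
    by_cases h : a = i
    · subst h
      nlinarith [mul_le_mul_of_nonneg_left (hd a) hest]
    · have : slackEstimate β s p a i = 0 := if_neg h
      rw [this]
      nlinarith
  refine (Finset.sum_le_sum fun i _ => h1 i).trans ?_
  rw [Finset.sum_add_distrib, ← Finset.sum_mul, ← Finset.sum_mul, hsum, sum_mul_slackEstimate,
    mul_slackEstimate_self hp]
  have hx := correctionFactor_nonneg (mul_nonneg hβ.le (hs a)) (hβs a) (hp a) (hp1 a)
  have h2 : s a * (1 - correctionFactor β (s a) (p a)) ≤ s a :=
    mul_le_of_le_one_right (hs a) (by linarith)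
  have h3 := mul_le_mul_of_nonneg_right h2 (by positivity : 0 ≤ slackEstimate β s p a a + 2 * d)
  have h4 := mul_le_mul_of_nonneg_right (hm a) hd0
  linarith

end Round

section Potential

variable {N : ℕ} [NeZero N]

/-- One step of the exponential weights with losses `v ≥ μ` of either sign. -/
lemma log_sum_exp_add_le {η μ : ℝ} (hη : 0 ≤ η) (L v : Fin N → ℝ) (hv : ∀ i, μ ≤ v i) :
    Real.log (∑ i, Real.exp (-η * (L i + v i)))
      ≤ Real.log (∑ i, Real.exp (-η * L i)) - η * ∑ i, expWeights η L i * v i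
        + η ^ 2 * ∑ i, expWeights η L i * (v i - μ) ^ 2 := by
  set p := expWeights η L with hpdef
  have hZ := sum_exp_pos η L
  have hp : ∀ i, 0 < p i := expWeights_pos η L
  have hsum : ∑ i, p i = 1 := sum_expWeights η L
  have h1 : ∑ i, Real.exp (-η * (L i + v i))
      = (∑ i, Real.exp (-η * L i)) * (Real.exp (-η * μ) * ∑ i, p i * Real.exp (-(η * (v i - μ)))) := by
    rw [Finset.mul_sum, Finset.mul_sum]
    refine Finset.sum_congr rfl fun i _ => ?_
    have e : Real.exp (-η * (L i + v i))
        = Real.exp (-η * L i) * (Real.exp (-η * μ) * Real.exp (-(η * (v i - μ)))) := by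
      rw [← Real.exp_add, ← Real.exp_add]; congr 1; ring
    rw [e, hpdef, expWeights]
    field_simp
  have h2 : ∑ i, p i * Real.exp (-(η * (v i - μ)))
      ≤ 1 + (-(η * (∑ i, p i * v i - μ)) + η ^ 2 * ∑ i, p i * (v i - μ) ^ 2) := by
    calc _ ≤ ∑ i, (p i - η * (p i * v i) + η * μ * p i + η ^ 2 * (p i * (v i - μ) ^ 2)) := by
          refine Finset.sum_le_sum fun i _ => ?_
          have := mul_le_mul_of_nonneg_left
            (exp_neg_le_one_sub_add_sq (mul_nonneg hη (sub_nonneg.2 (hv i)))) (hp i).le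
          linarith
      _ = _ := by
          rw [Finset.sum_add_distrib, Finset.sum_add_distrib, Finset.sum_sub_distrib,
            ← Finset.mul_sum, ← Finset.mul_sum, ← Finset.mul_sum, hsum]
          ring
  have h3 : 0 < ∑ i, p i * Real.exp (-(η * (v i - μ))) :=
    Finset.sum_pos (fun i _ => mul_pos (hp i) (Real.exp_pos _)) Finset.univ_nonempty
  rw [h1, Real.log_mul hZ.ne' (mul_pos (Real.exp_pos _) h3).ne',
    Real.log_mul (Real.exp_pos _).ne' h3.ne', Real.log_exp]
  have h4 := Real.log_le_sub_one_of_pos h3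
  linarith

lemma sub_le_spread (x : Fin N → ℝ) (i j : Fin N) : x i - x j ≤ spread x :=
  sub_le_sub (Finset.le_sup' x (Finset.mem_univ i)) (Finset.inf'_le x (Finset.mem_univ j))

lemma spread_nonneg (x : Fin N → ℝ) : 0 ≤ spread x := by
  have := sub_le_spread x 0 0
  rwa [sub_self] at this

/-- One round of Exp3.LB.P: the loss of the drawn action is paid for by the stochastic excess, a
deterministic second-order term and the decrease of the potential. -/
lemma round_bound (hN : 2 ≤ N) {β η m : ℝ} (hβ : 0 < β) (hη : 0 < η) (L l lam : Fin N → ℝ)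
    (hle : ∀ i, lam i ≤ l i) (hβs : ∀ i, β * (l i - lam i) ≤ 1) (hm : ∀ i, l i - lam i ≤ m)
    (a : Fin N) :
    l a ≤ excess β η (fun i => l i - lam i) lam (expWeights η L) a
      + η * (spread lam ^ 2 + 2 * (m * spread lam))
      + (Real.log (∑ i, Real.exp (-η * L i))
        - Real.log (∑ i, Real.exp (-η * (L i
          + (slackEstimate β (fun i => l i - lam i) (expWeights η L) a i + lam i))))) / η := by
  set p := expWeights η L with hpdef
  set s : Fin N → ℝ := fun i => l i - lam i with hsdef
  have hp : ∀ i, 0 < p i := expWeights_pos η L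
  have hp1 : ∀ i, p i < 1 := expWeights_lt_one hN η L
  have hsum : ∑ i, p i = 1 := sum_expWeights η L
  have hs : ∀ i, 0 ≤ s i := fun i => sub_nonneg.2 (hle i)
  obtain ⟨j, -, hj⟩ := Finset.exists_mem_eq_inf' Finset.univ_nonempty lam
  have hμ : ∀ i, lam j ≤ lam i := fun i => hj ▸ Finset.inf'_le lam (Finset.mem_univ i)
  have h1 := log_sum_exp_add_le hη.le L (fun i => slackEstimate β s p a i + lam i)
    (fun i => (hμ i).trans (le_add_of_nonneg_left (slackEstimate_nonneg hβ hs hβs hp hp1 a i)))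
  have h2 := sum_mul_sq_le hβ hs hβs hp hp1 hsum hμ (fun i => sub_le_spread lam i j) hm a
  have h3 : ∑ i, p i * (slackEstimate β s p a i + lam i)
      = s a * (1 - correctionFactor β (s a) (p a)) + ∑ i, p i * lam i := by
    simp only [mul_add]
    rw [Finset.sum_add_distrib, sum_mul_slackEstimate, mul_slackEstimate_self hp]
  rw [← hpdef] at h1
  simp only [h3] at h1
  have h4 := mul_le_mul_of_nonneg_left h2 (sq_nonneg η)
  have h5 : l a = s a + lam a := by simp [hsdef]
  rw [← sub_le_iff_le_add', le_div_iff₀ hη, h5, excess]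
  linarith

end Potential

/-! ### The regret on a fixed sequence of actions -/

section Pathwise

variable {N : ℕ} [NeZero N] {T : ℕ} {l lam : ℕ → Fin N → ℝ} {β η : ℝ}

/-- `excess` along a play. -/
noncomputable def roundExcess (β η : ℝ) (l lam : ℕ → Fin N → ℝ) (t : ℕ) (h : Fin t → Fin N)
    (a : Fin N) : ℝ :=
  excess β η (fun i => l t i - lam t i) (lam t) (expWeights η (estCumLoss η β l lam t h)) a

/-- The error of the estimate of the slack of action `k` along a play. -/
noncomputable def slackError (β η : ℝ) (l lam : ℕ → Fin N → ℝ) (k : Fin N) (t : ℕ)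
    (h : Fin t → Fin N) (a : Fin N) : ℝ :=
  slackEstimate β (fun i => l t i - lam t i) (expWeights η (estCumLoss η β l lam t h)) a k
    - (l t k - lam t k)

omit [NeZero N] in
lemma estCumLoss_eq (h : Fin T → Fin N) (k : Fin N) :
    estCumLoss η β l lam T h k = accum (slackError β η l lam k) T h
      + ∑ t ∈ Finset.range T, l t k := by
  induction T with
  | zero => simp [estCumLoss, accum]
  | succ t ih =>
    rw [estCumLoss, accum, Finset.sum_range_succ, slackError, slackEstimate]
    simp only [ih]
    ring

lemma sum_loss_le (hN : 2 ≤ N) (hβ : 0 < β) (hη : 0 < η) (m : ℕ → ℝ)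
    (hle : ∀ t < T, ∀ i, lam t i ≤ l t i) (hβs : ∀ t < T, ∀ i, β * (l t i - lam t i) ≤ 1)
    (hm : ∀ t < T, ∀ i, l t i - lam t i ≤ m t) (h : Fin T → Fin N) :
    ∑ t : Fin T, l t (h t) ≤ accum (roundExcess β η l lam) T h
      + η * ∑ t ∈ Finset.range T, (spread (lam t) ^ 2 + 2 * (m t * spread (lam t)))
      + (Real.log N - Real.log (∑ i, Real.exp (-η * estCumLoss η β l lam T h i))) / η := by
  induction T with
  | zero => simp [accum, estCumLoss]
  | succ t ih =>
    have h1 := ih (fun j hj => hle j (hj.trans t.lt_succ_self))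
      (fun j hj => hβs j (hj.trans t.lt_succ_self)) (fun j hj => hm j (hj.trans t.lt_succ_self))
      (Fin.init h)
    have h2 := round_bound hN hβ hη (estCumLoss η β l lam t (Fin.init h)) (l t) (lam t)
      (hle t t.lt_succ_self) (hβs t t.lt_succ_self) (hm t t.lt_succ_self) (h (Fin.last t))
    have e : ∀ i, estCumLoss η β l lam (t + 1) h i = estCumLoss η β l lam t (Fin.init h) i
        + (slackEstimate β (fun i => l t i - lam t i)
          (expWeights η (estCumLoss η β l lam t (Fin.init h))) (h (Fin.last t)) i + lam t i) :=
      fun _ => rfl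
    simp only [e]
    rw [Fin.sum_univ_castSucc, accum, roundExcess, Finset.sum_range_succ]
    have h3 : ∑ j : Fin t, l j.castSucc (h j.castSucc) = ∑ j : Fin t, l j (Fin.init h j) := rfl
    have h4 : l (Fin.last t) (h (Fin.last t)) = l t (h (Fin.last t)) := rfl
    rw [h3, h4]
    rw [sub_div] at h1 h2 ⊢
    linarith

lemma sum_sup'_mul_spread_nonneg (hle : ∀ t < T, ∀ i, lam t i ≤ l t i) :
    0 ≤ ∑ t ∈ Finset.range T,
      Finset.univ.sup' Finset.univ_nonempty (fun i => l t i - lam t i) * spread (lam t) := by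
  refine Finset.sum_nonneg fun t ht => mul_nonneg ?_ (spread_nonneg _)
  exact (sub_nonneg.2 (hle t (Finset.mem_range.1 ht) 0)).trans
    (Finset.le_sup' (fun i => l t i - lam t i) (Finset.mem_univ 0))

/-- If the slack estimates of all actions are accurate, then the regret is controlled by the
accumulated excess. -/
lemma regret_le (hN : 2 ≤ N) (hβ : 0 < β) (hη : 0 < η) {Q D : ℝ}
    (hle : ∀ t < T, ∀ i, lam t i ≤ l t i) (hQ : lbVariation T l lam ≤ Q)
    (hβs : ∀ t < T, ∀ i, β * (l t i - lam t i) ≤ 1) (h : Fin T → Fin N)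
    (hD : ∀ k, accum (slackError β η l lam k) T h ≤ D) :
    regret T l h ≤ accum (roundExcess β η l lam) T h + 2 * η * Q + Real.log N / η + D := by
  obtain ⟨k, -, hk⟩ := Finset.exists_mem_eq_inf' (Finset.univ_nonempty (α := Fin N))
    fun k => ∑ t ∈ Finset.range T, l t k
  rw [regret, hk]
  have h1 := sum_loss_le hN hβ hη
    (fun t => Finset.univ.sup' Finset.univ_nonempty fun i => l t i - lam t i) hle hβs
    (fun t _ i => Finset.le_sup' (fun i => l t i - lam t i) (Finset.mem_univ i)) h
  have h2 : -η * estCumLoss η β l lam T h k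
      ≤ Real.log (∑ i, Real.exp (-η * estCumLoss η β l lam T h i)) := by
    rw [Real.le_log_iff_exp_le (sum_exp_pos _ _)]
    exact Finset.single_le_sum (f := fun i => Real.exp (-η * estCumLoss η β l lam T h i))
      (fun i _ => (Real.exp_pos _).le) (Finset.mem_univ k)
  have h3 : (Real.log N - Real.log (∑ i, Real.exp (-η * estCumLoss η β l lam T h i))) / η
      ≤ Real.log N / η + estCumLoss η β l lam T h k := by
    rw [← sub_le_iff_le_add', ← sub_div, div_le_iff₀ hη]
    linarith
  have h4 : ∑ t ∈ Finset.range T, (spread (lam t) ^ 2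
      + 2 * (Finset.univ.sup' Finset.univ_nonempty (fun i => l t i - lam t i) * spread (lam t)))
      ≤ 2 * Q := by
    rw [Finset.sum_add_distrib, ← Finset.mul_sum]
    have : 0 ≤ ∑ t ∈ Finset.range T, ∑ i, (l t i - lam t i) ^ 2 :=
      Finset.sum_nonneg fun _ _ => Finset.sum_nonneg fun _ _ => sq_nonneg _
    have := sum_sup'_mul_spread_nonneg hle
    rw [lbVariation] at hQ
    linarith
  have h5 := mul_le_mul_of_nonneg_left h4 hη.le
  rw [estCumLoss_eq] at h3
  have := hD k
  linarith

end Pathwise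

/-! ### High-probability bounds -/

lemma log_add_three_div_le {N : ℕ} (hN : 2 ≤ N) {δ : ℝ} (hδ : 0 < δ) (hδ1 : δ < 1) :
    Real.log ((N + 3) / δ) ≤ 3 * Real.log (N / δ) := by
  have hN2 : (2 : ℝ) ≤ N := by exact_mod_cast hN
  have h1 : (N + 3) / δ ≤ (N / δ) ^ 3 := by
    rw [div_pow, div_le_div_iff₀ hδ (by positivity)]
    have h2 : (N : ℝ) + 3 ≤ N ^ 3 := by nlinarith [sq_nonneg ((N : ℝ) - 2)]
    have h3 : δ ^ 3 ≤ δ := by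
      have := pow_le_pow_of_le_one hδ.le hδ1.le (show 1 ≤ 3 by norm_num)
      rwa [pow_one] at this
    exact mul_le_mul h2 h3 (by positivity) (by positivity)
  have h4 := Real.log_le_log (by positivity) h1
  rwa [Real.log_pow] at h4

lemma one_half_le_log_div {N : ℕ} (hN : 2 ≤ N) {δ : ℝ} (hδ : 0 < δ) (hδ1 : δ < 1) :
    1 / 2 ≤ Real.log (N / δ) := by
  have hN2 : (2 : ℝ) ≤ N := by exact_mod_cast hN
  have h1 : Real.log 2 ≤ Real.log (N / δ) :=
    Real.log_le_log (by norm_num) (hN2.trans (le_div_self (by linarith) hδ hδ1.le))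
  linarith [Real.log_two_gt_d9]

section HighProbability

variable {N : ℕ} [NeZero N] {T : ℕ} {l lam : ℕ → Fin N → ℝ} {β η : ℝ}

lemma sup'_sq_le_sum_sq (s : Fin N → ℝ) :
    Finset.univ.sup' Finset.univ_nonempty s ^ 2 ≤ ∑ i, s i ^ 2 := by
  obtain ⟨j, -, hj⟩ := Finset.exists_mem_eq_sup' (Finset.univ_nonempty (α := Fin N)) s
  rw [hj]
  exact Finset.single_le_sum (f := fun i => s i ^ 2) (fun i _ => sq_nonneg _) (Finset.mem_univ j)

lemma sum_sq_slack_le {Q : ℝ} (hle : ∀ t < T, ∀ i, lam t i ≤ l t i)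
    (hQ : lbVariation T l lam ≤ Q) :
    ∑ t ∈ Finset.range T, ∑ i, (l t i - lam t i) ^ 2 ≤ Q / 2 := by
  have h1 := sum_sup'_mul_spread_nonneg hle
  have h2 : 0 ≤ ∑ t ∈ Finset.range T, spread (lam t) ^ 2 :=
    Finset.sum_nonneg fun _ _ => sq_nonneg _
  rw [lbVariation] at hQ
  linarith

/-- The ranges `d(λ_t) + ρ max_i s_{i,t}` of the accumulated excess are square summable to order
`ρ ^ 2 Q`. -/
lemma sum_sq_range_le {Q ρ : ℝ} (hρ : 1 ≤ ρ) (hle : ∀ t < T, ∀ i, lam t i ≤ l t i)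
    (hQ : lbVariation T l lam ≤ Q) :
    ∑ t ∈ Finset.range T, (spread (lam t)
      + Finset.univ.sup' Finset.univ_nonempty (fun i => l t i - lam t i) * ρ) ^ 2
      ≤ 4 * ρ ^ 2 * Q := by
  have h0 := sum_sup'_mul_spread_nonneg hle
  have h2 : 0 ≤ ∑ t ∈ Finset.range T, ∑ i, (l t i - lam t i) ^ 2 :=
    Finset.sum_nonneg fun _ _ => Finset.sum_nonneg fun _ _ => sq_nonneg _
  have hρ2 : 1 ≤ ρ ^ 2 := one_le_pow₀ hρ
  calc _ ≤ ∑ t ∈ Finset.range T,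
        ρ ^ 2 * (2 * spread (lam t) ^ 2 + 2 * ∑ i, (l t i - lam t i) ^ 2) := by
        refine Finset.sum_le_sum fun t _ => ?_
        have h1 := sup'_sq_le_sum_sq fun i => l t i - lam t i
        set m := Finset.univ.sup' Finset.univ_nonempty (fun i => l t i - lam t i)
        have h3 := mul_le_mul_of_nonneg_left h1 (sq_nonneg ρ)
        have h4 := mul_le_mul_of_nonneg_right hρ2 (sq_nonneg (spread (lam t)))
        nlinarith [sq_nonneg (spread (lam t) - m * ρ)]
    _ = ρ ^ 2 * (2 * ∑ t ∈ Finset.range T, spread (lam t) ^ 2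
          + 2 * ∑ t ∈ Finset.range T, ∑ i, (l t i - lam t i) ^ 2) := by
        rw [← Finset.mul_sum, Finset.sum_add_distrib, Finset.mul_sum, Finset.mul_sum]
    _ ≤ ρ ^ 2 * (4 * Q) := by
        refine mul_le_mul_of_nonneg_left ?_ (sq_nonneg ρ)
        rw [lbVariation] at hQ
        linarith
    _ = _ := by ring

/-- The union bound over the accumulated excess and the `N` slack errors, with a free parameter `c`
in the exponential moment of the excess. -/
lemma regretBound_of_parameter (hN : 2 ≤ N) (hβ : 0 < β) (hη : 0 < η) {Q c δ : ℝ} (hc : 0 < c)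
    (hδ : 0 < δ) (hle : ∀ t < T, ∀ i, lam t i ≤ l t i) (hQ : lbVariation T l lam ≤ Q)
    (hβs : ∀ t < T, ∀ i, β * (l t i - lam t i) ≤ 1) :
    RegretBound η β T l lam δ
      ((β + η) * (Q / 2) + c * (4 * (1 + η / β) ^ 2 * Q) + Real.log (2 / δ) / c
        + 2 * η * Q + Real.log N / η + Real.log (2 * N / δ) / β) := by
  have hN0 : (0 : ℝ) < N := by positivity
  set b : ℕ → ℝ := fun t => c * ((β + η) * ∑ i, (l t i - lam t i) ^ 2)
    + c ^ 2 * (spread (lam t) + Finset.univ.sup' Finset.univ_nonempty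
      (fun i => l t i - lam t i) * (1 + η / β)) ^ 2 with hb
  have hε : ∑ j : Option (Fin N), (j.elim (δ / 2) fun _ => δ / (2 * N)) = δ := by
    rw [Fintype.sum_option]
    simp only [Option.elim, Finset.sum_const, Finset.card_univ, Fintype.card_fin, nsmul_eq_mul]
    field_simp
    norm_num
  refine (congrArg (fun x => ENNReal.ofReal (1 - x)) hε).ge.trans ?_
  refine one_sub_le_law_of_accum η β l lam T
    (fun j : Option (Fin N) => j.elim (fun t h a => c * roundExcess β η l lam t h a - b t)
      fun k t h a => β * slackError β η l lam k t h a) _ ?_ ?_ _ ?_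
  · rintro (_ | _) <;> simp only [Option.elim] <;> positivity
  · intro j t ht h
    have hp := expWeights_pos η (estCumLoss η β l lam t h)
    have hp1 := expWeights_lt_one hN η (estCumLoss η β l lam t h)
    have hsum := sum_expWeights η (estCumLoss η β l lam t h)
    have hs : ∀ i, 0 ≤ l t i - lam t i := fun i => sub_nonneg.2 (hle t ht i)
    rcases j with _ | k
    · exact sum_mul_exp_le (fun i => (hp i).le) hsum hc.le
        (mul_nonneg (by positivity) (Finset.sum_nonneg fun _ _ => sq_nonneg _))
        (sum_mul_excess_le hβ hη.le hs (hβs t ht) hp hp1 hsum)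
        (abs_excess_le hβ hη.le hs (hβs t ht) hp hp1 hsum (sub_le_spread (lam t))
          fun i => Finset.le_sup' (fun i => l t i - lam t i) (Finset.mem_univ i))
    · exact sum_mul_exp_slackEstimate_le_one hβ hs (hβs t ht) hp hp1 hsum k
  · intro h hh
    have h1 := hh none
    simp only [Option.elim] at h1
    rw [accum_sub_sum, accum_const_mul, one_div_div] at h1
    have h2 : ∑ t ∈ Finset.range T, b t
        ≤ c * ((β + η) * (Q / 2)) + c ^ 2 * (4 * (1 + η / β) ^ 2 * Q) := by
      rw [hb, Finset.sum_add_distrib, ← Finset.mul_sum, ← Finset.mul_sum, ← Finset.mul_sum]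
      exact add_le_add
        (mul_le_mul_of_nonneg_left (mul_le_mul_of_nonneg_left (sum_sq_slack_le hle hQ)
          (by positivity)) hc.le)
        (mul_le_mul_of_nonneg_left (sum_sq_range_le
          (le_add_of_nonneg_right (by positivity)) hle hQ) (sq_nonneg c))
    have h3 : accum (roundExcess β η l lam) T h
        ≤ (β + η) * (Q / 2) + c * (4 * (1 + η / β) ^ 2 * Q) + Real.log (2 / δ) / c := by
      refine le_of_mul_le_mul_left ?_ hc
      have e : c * (Real.log (2 / δ) / c) = Real.log (2 / δ) := mul_div_cancel₀ _ hc.ne'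
      rw [mul_add, mul_add, e]
      linarith
    have h4 : ∀ k, accum (slackError β η l lam k) T h ≤ Real.log (2 * N / δ) / β := by
      intro k
      have h5 := hh (some k)
      simp only [Option.elim] at h5
      rw [accum_const_mul, one_div_div] at h5
      rwa [le_div_iff₀' hβ]
    have h6 := regret_le hN hβ hη hle hQ hβs h h4
    exact h6.trans (by linarith)

/-- The regret bound of Exp3.LB.P for the prescribed `η` and an arbitrary `β`. -/
lemma regretBound_of_two_le (hN : 2 ≤ N) (hβ : 0 < β) {Q δ : ℝ} (hδ : 0 < δ) (hδ1 : δ < 1)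
    (hQ0 : 0 < Q) (hle : ∀ t < T, ∀ i, lam t i ≤ l t i) (hQ : lbVariation T l lam ≤ Q)
    (hβs : ∀ t < T, ∀ i, β * (l t i - lam t i) ≤ 1) :
    RegretBound (√(4 / Q * Real.log N)) β T l lam δ
      (12 * (Real.log (N / δ) / β) + 11 * √(Q * Real.log (N / δ)) + β * Q / 2) := by
  have hN2 : (2 : ℝ) ≤ N := by exact_mod_cast hN
  have hN0 : (0 : ℝ) < N := by linarith
  have hlogN : 0 < Real.log N := Real.log_pos (by linarith)
  have hΛ : Real.log N ≤ Real.log (N / δ) :=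
    Real.log_le_log hN0 (le_div_self hN0.le hδ hδ1.le)
  have hΛ1 : Real.log (2 / δ) ≤ Real.log (N / δ) :=
    Real.log_le_log (by positivity) (by gcongr)
  have hΛ2 : Real.log (2 * N / δ) ≤ 2 * Real.log (N / δ) := by
    rw [mul_div_assoc, Real.log_mul (by norm_num) (by positivity)]
    have : Real.log 2 ≤ Real.log N := Real.log_le_log (by norm_num) hN2
    linarith
  obtain ⟨u, hu, rfl⟩ : ∃ u : ℝ, 0 < u ∧ u ^ 2 = Q := ⟨√Q, Real.sqrt_pos.2 hQ0, Real.sq_sqrt hQ0.le⟩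
  generalize Real.log (N / δ) = Λ at *
  obtain ⟨v, hv, rfl⟩ : ∃ v : ℝ, 0 < v ∧ v ^ 2 = Λ :=
    ⟨√Λ, Real.sqrt_pos.2 (hlogN.trans_le hΛ), Real.sq_sqrt (hlogN.le.trans hΛ)⟩
  obtain ⟨n, hn, hn2⟩ : ∃ n : ℝ, 0 < n ∧ n ^ 2 = Real.log N :=
    ⟨√(Real.log N), Real.sqrt_pos.2 hlogN, Real.sq_sqrt hlogN.le⟩
  have hnv : n ≤ v := by
    rw [← hn2] at hΛ
    exact (abs_le_of_sq_le_sq' hΛ hv.le).2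
  have hη : √(4 / u ^ 2 * Real.log N) = 2 * n / u := by
    rw [← hn2, show 4 / u ^ 2 * n ^ 2 = (2 * n / u) ^ 2 by ring]
    exact Real.sqrt_sq (by positivity)
  -- below, `u = √Q`, `v = √(log (N / δ))` and `n = √(log N)`, with `n ≤ v`
  have huv : √(u ^ 2 * v ^ 2) = u * v := by
    rw [← mul_pow]
    exact Real.sqrt_sq (by positivity)
  rw [hη, huv]
  -- the part `η / β` of `ρ` costs `n v / β`, which is absorbed by `v ^ 2 / β`
  set ρ := 1 + 2 * n / u / β with hρ
  have hρ0 : 0 < ρ := by positivity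
  -- `c` balances `c * 4 ρ² Q` against `log (2 / δ) / c`
  refine (regretBound_of_parameter hN hβ (by positivity) (c := v / (u * ρ)) (by positivity) hδ
    hle hQ hβs).mono ?_
  rw [← hρ, ← hn2]
  have e1 : v / (u * ρ) * (4 * ρ ^ 2 * u ^ 2) = 4 * (u * v) * ρ := by field_simp
  have e2 : Real.log (2 / δ) / (v / (u * ρ)) ≤ (u * v) * ρ := by
    rw [div_le_iff₀ (by positivity)]
    have : u * v * ρ * (v / (u * ρ)) = v ^ 2 := by field_simp
    rw [this]
    exact hΛ1
  have e3 : u * v * ρ = u * v + 2 * (n * v / β) := by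
    rw [hρ]; field_simp
  have e4 : n * v / β ≤ v ^ 2 / β := by
    refine div_le_div_of_nonneg_right ?_ hβ.le
    nlinarith
  have e5 : (β + 2 * n / u) * (u ^ 2 / 2) = β * u ^ 2 / 2 + n * u := by field_simp
  have e6 : 2 * (2 * n / u) * u ^ 2 = 4 * (n * u) := by field_simp; norm_num
  have e7 : n ^ 2 / (2 * n / u) = n * u / 2 := by field_simp
  have e8 : Real.log (2 * N / δ) / β ≤ 2 * (v ^ 2 / β) := by
    rw [← mul_div_assoc]
    exact div_le_div_of_nonneg_right hΛ2 hβ.le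
  have e9 : n * u ≤ u * v := by nlinarith
  have e10 : 0 ≤ u * v := by positivity
  rw [e1, e5, e6, e7]
  linarith

lemma log_div_le_log_add_three_div {δ : ℝ} (hδ : 0 < δ) :
    Real.log (N / δ) ≤ Real.log ((N + 3) / δ) := by
  have : (0 : ℝ) < N := by have := NeZero.pos N; positivity
  exact Real.log_le_log (by positivity) (by gcongr; linarith)

lemma log_div_nonneg {δ : ℝ} (hδ : 0 < δ) (hδ1 : δ < 1) : 0 ≤ Real.log (N / δ) := by
  have : (1 : ℝ) ≤ N := by exact_mod_cast NeZero.pos N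
  exact Real.log_nonneg (this.trans (le_div_self (by linarith) hδ hδ1.le))

lemma regret_of_card_eq_one (hN : N = 1) (h : Fin T → Fin N) : regret T l h = 0 := by
  subst hN
  have h1 : ∀ t : Fin T, h t = 0 := fun t => Subsingleton.elim _ _
  have h2 : (Finset.univ.inf' Finset.univ_nonempty fun k : Fin 1 => ∑ t ∈ Finset.range T, l t k)
      = ∑ t ∈ Finset.range T, l t 0 :=
    le_antisymm (Finset.inf'_le _ (Finset.mem_univ 0))
      (Finset.le_inf' _ _ fun k _ => by rw [Subsingleton.elim k 0])
  rw [regret, h2, Finset.sum_range]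
  simp [h1]

lemma regret_le_card (hl : ∀ t < T, ∀ i, 0 ≤ l t i ∧ l t i ≤ 1) (h : Fin T → Fin N) :
    regret T l h ≤ T := by
  have h1 : ∑ t : Fin T, l t (h t) ≤ ∑ _t : Fin T, (1 : ℝ) :=
    Finset.sum_le_sum fun t _ => (hl t t.2 (h t)).2
  have h2 : (0 : ℝ) ≤ Finset.univ.inf' Finset.univ_nonempty
      fun k => ∑ t ∈ Finset.range T, l t k :=
    Finset.le_inf' _ _ fun k _ => Finset.sum_nonneg fun t ht => (hl t (Finset.mem_range.1 ht) k).1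
  rw [regret]
  simp only [Finset.sum_const, Finset.card_univ, Fintype.card_fin, nsmul_eq_mul, mul_one] at h1
  linarith

lemma regretBound_of_card_eq_one (hN : N = 1) {δ B : ℝ} (hδ : 0 < δ) (hB : 0 ≤ B) :
    RegretBound η β T l lam δ B :=
  regretBound_of_forall hδ fun h => (regret_of_card_eq_one hN h).trans_le hB

lemma two_le_of_ne_one (hN : N ≠ 1) : 2 ≤ N := by
  have := NeZero.pos N
  omega

/-- The bound for `β` tuned to the confidence level. -/
lemma regretBound_tuned {Q δ : ℝ} (hδ : 0 < δ) (hδ1 : δ < 1) (hQ0 : 0 < Q)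
    (hle : ∀ t < T, ∀ i, lam t i ≤ l t i) (hQ : lbVariation T l lam ≤ Q)
    (hβs : ∀ t < T, ∀ i, √(2 / Q * Real.log ((N + 3) / δ)) * (l t i - lam t i) ≤ 1) :
    RegretBound (√(4 / Q * Real.log N)) (√(2 / Q * Real.log ((N + 3) / δ))) T l lam δ
      (28 * √(Q * Real.log (N / δ))) := by
  by_cases hN : N = 1
  · exact regretBound_of_card_eq_one hN hδ (by positivity)
  replace hN := two_le_of_ne_one hN
  have hA1 := log_add_three_div_le hN hδ hδ1
  have hA2 := log_div_le_log_add_three_div (N := N) hδ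
  have hΛ := one_half_le_log_div hN hδ hδ1
  have hA : 0 < Real.log ((N + 3) / δ) := by linarith
  refine (regretBound_of_two_le hN (Real.sqrt_pos.2 (by positivity)) hδ hδ1 hQ0 hle hQ hβs).mono ?_
  generalize Real.log ((N + 3) / δ) = A at *
  generalize Real.log (N / δ) = Λ at *
  set β := √(2 / Q * A) with hβ
  set w := √(Q * Λ) with hw
  have hβ0 : 0 < β := Real.sqrt_pos.2 (by positivity)
  have hw0 : 0 ≤ w := Real.sqrt_nonneg _
  have hw2 : w ^ 2 = Q * Λ := Real.sq_sqrt (by positivity)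
  have hβ2 : β ^ 2 * Q = 2 * A := by
    rw [hβ, Real.sq_sqrt (by positivity)]; field_simp
  have h1 : Λ / β ≤ w := by
    rw [div_le_iff₀ hβ0]
    refine (abs_le_of_sq_le_sq' ?_ (by positivity)).2
    have : (w * β) ^ 2 = 2 * A * Λ := by rw [mul_pow, hw2, ← hβ2]; ring
    rw [this]
    nlinarith
  have h2 : β * Q ≤ 3 * w := by
    refine (abs_le_of_sq_le_sq' ?_ (by positivity)).2
    have : (β * Q) ^ 2 = 2 * A * Q := by rw [← hβ2]; ring
    rw [this, mul_pow, hw2]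
    nlinarith
  linarith

/-- The bound for `β` independent of the confidence level. Here `β s ≤ 1` is automatic, since every
squared slack is at most `Q / 2`. -/
lemma regretBound_untuned {Q δ : ℝ} (hδ : 0 < δ) (hδ1 : δ < 1) (hQ0 : 0 < Q)
    (hle : ∀ t < T, ∀ i, lam t i ≤ l t i) (hQ : lbVariation T l lam ≤ Q) :
    RegretBound (√(4 / Q * Real.log N)) (√(2 / Q)) T l lam δ
      (50 * (√Q * Real.log (N / δ))) := by
  by_cases hN : N = 1
  · have := log_div_nonneg (N := N) hδ hδ1
    exact regretBound_of_card_eq_one hN hδ (by positivity)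
  replace hN := two_le_of_ne_one hN
  have hΛ := one_half_le_log_div hN hδ hδ1
  have hβs : ∀ t < T, ∀ i, √(2 / Q) * (l t i - lam t i) ≤ 1 := by
    intro t ht i
    have h1 : (l t i - lam t i) ^ 2 ≤ Q / 2 :=
      ((Finset.single_le_sum (f := fun i => (l t i - lam t i) ^ 2) (fun i _ => sq_nonneg _)
        (Finset.mem_univ i)).trans (Finset.single_le_sum
          (f := fun t => ∑ i, (l t i - lam t i) ^ 2)
          (fun t _ => Finset.sum_nonneg fun i _ => sq_nonneg _)
          (Finset.mem_range.2 ht))).trans (sum_sq_slack_le hle hQ)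
    refine (abs_le_of_sq_le_sq' ?_ zero_le_one).2
    rw [mul_pow, Real.sq_sqrt (by positivity)]
    calc 2 / Q * (l t i - lam t i) ^ 2 ≤ 2 / Q * (Q / 2) := by gcongr
      _ = 1 ^ 2 := by field_simp
  refine (regretBound_of_two_le hN (Real.sqrt_pos.2 (by positivity)) hδ hδ1 hQ0 hle hQ hβs).mono ?_
  generalize Real.log (N / δ) = Λ at *
  obtain ⟨u, hu, rfl⟩ : ∃ u : ℝ, 0 < u ∧ u ^ 2 = Q := ⟨√Q, Real.sqrt_pos.2 hQ0, Real.sq_sqrt hQ0.le⟩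
  set β := √(2 / u ^ 2) with hβ
  have hβ0 : 0 < β := Real.sqrt_pos.2 (by positivity)
  have hβu : β ^ 2 * u ^ 2 = 2 := by
    rw [hβ, Real.sq_sqrt (by positivity)]; field_simp
  have h0 : 1 ≤ β * u := by
    refine (abs_le_of_sq_le_sq' ?_ (by positivity)).2
    rw [mul_pow, hβu]; norm_num
  have h0' : β * u ≤ 2 := by
    refine (abs_le_of_sq_le_sq' ?_ (by norm_num)).2
    rw [mul_pow, hβu]; norm_num
  rw [Real.sqrt_sq hu.le, Real.sqrt_mul (by positivity), Real.sqrt_sq hu.le]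
  have h1 : Λ / β ≤ u * Λ := by
    rw [div_le_iff₀ hβ0]
    nlinarith
  have h2 : √Λ ≤ 2 * Λ := by
    rw [Real.sqrt_le_left (by positivity)]
    nlinarith
  have h3 := mul_le_mul_of_nonneg_left h2 hu.le
  have h4 : β * u ^ 2 ≤ 4 * (u * Λ) := by nlinarith [mul_pos hu hu]
  nlinarith [mul_pos hu (show 0 < Λ by linarith)]

/-- The bound for losses in `[0, 1]`. If `β` is truncated to `1`, then `Q` is so small that already
the trivial bound `T` on the regret suffices. -/
lemma regretBound_truncated {Q δ : ℝ} (hδ : 0 < δ) (hδ1 : δ < 1) (hQ0 : 0 < Q)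
    (hle : ∀ t < T, ∀ i, lam t i ≤ l t i) (hQ : lbVariation T l lam ≤ Q)
    (hl : ∀ t < T, ∀ i, 0 ≤ lam t i ∧ l t i ≤ 1) (hTQ : 2 * T ≤ Q) :
    RegretBound (√(4 / Q * Real.log N)) (min 1 (√(2 / Q * Real.log ((N + 3) / δ)))) T l lam δ
      (28 * √(Q * Real.log (N / δ))) := by
  by_cases hN : N = 1
  · exact regretBound_of_card_eq_one hN hδ (by positivity)
  replace hN := two_le_of_ne_one hN
  rcases le_total (√(2 / Q * Real.log ((N + 3) / δ))) 1 with h | h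
  · rw [min_eq_right h]
    refine regretBound_tuned hδ hδ1 hQ0 hle hQ fun t ht i => ?_
    have := hle t ht i
    have := hl t ht i
    exact mul_le_one₀ h (by linarith) (by linarith)
  · rw [min_eq_left h]
    refine regretBound_of_forall hδ fun g => (regret_le_card (fun t ht i =>
      ⟨(hl t ht i).1.trans (hle t ht i), (hl t ht i).2⟩) g).trans ?_
    have hA1 := log_add_three_div_le hN hδ hδ1
    rw [Real.one_le_sqrt, div_mul_eq_mul_div, one_le_div hQ0] at h
    have h1 : Q ≤ 28 * √(Q * Real.log (N / δ)) := by
      rw [← div_le_iff₀' (by norm_num)]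
      refine Real.le_sqrt_of_sq_le ?_
      nlinarith
    linarith

end HighProbability

/-! ### The variation of losses in `[0, 1]` -/

lemma spread_const {N : ℕ} [NeZero N] (c : ℝ) : spread (fun _ : Fin N => c) = 0 := by
  rw [spread, Finset.sup'_const, Finset.inf'_const, sub_self]

lemma spread_le_one {N : ℕ} [NeZero N] {x : Fin N → ℝ} (hx : ∀ i, 0 ≤ x i ∧ x i ≤ 1) :
    spread x ≤ 1 := by
  have h1 : Finset.univ.sup' Finset.univ_nonempty x ≤ 1 := Finset.sup'_le _ _ fun i _ => (hx i).2
  have h2 : 0 ≤ Finset.univ.inf' Finset.univ_nonempty x := Finset.le_inf' _ _ fun i _ => (hx i).1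
  rw [spread]
  linarith

lemma lbVariation_zero_le {N : ℕ} [NeZero N] {T : ℕ} {l : ℕ → Fin N → ℝ}
    (hl : ∀ t < T, ∀ i, 0 ≤ l t i ∧ l t i ≤ 1) :
    lbVariation T l (fun _ _ => 0) ≤ 2 * N * T := by
  have h1 : ∑ t ∈ Finset.range T, ∑ i, l t i ^ 2 ≤ ∑ _t ∈ Finset.range T, ∑ _i : Fin N, (1 : ℝ) :=
    Finset.sum_le_sum fun t ht => Finset.sum_le_sum fun i _ =>
      pow_le_one₀ (hl t (Finset.mem_range.1 ht) i).1 (hl t (Finset.mem_range.1 ht) i).2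
  simp only [Finset.sum_const, Finset.card_univ, Fintype.card_fin, nsmul_eq_mul, mul_one,
    Finset.card_range] at h1
  simp only [lbVariation, spread_const, sub_zero, mul_zero, Finset.sum_const_zero, ne_eq,
    OfNat.ofNat_ne_zero, not_false_eq_true, zero_pow, zero_add, add_zero]
  linarith

lemma lbVariation_self_le {N : ℕ} [NeZero N] {T : ℕ} {l : ℕ → Fin N → ℝ}
    (hl : ∀ t < T, ∀ i, 0 ≤ l t i ∧ l t i ≤ 1) : lbVariation T l l ≤ 2 * T := by
  have h1 : ∑ t ∈ Finset.range T, spread (l t) ^ 2 ≤ ∑ _t ∈ Finset.range T, (1 : ℝ) :=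
    Finset.sum_le_sum fun t ht =>
      pow_le_one₀ (spread_nonneg _) (spread_le_one (hl t (Finset.mem_range.1 ht)))
  simp only [Finset.sum_const, nsmul_eq_mul, mul_one, Finset.card_range] at h1
  simp only [lbVariation, sub_self, Finset.sup'_const, zero_mul, mul_zero, Finset.sum_const_zero,
    ne_eq, OfNat.ofNat_ne_zero, not_false_eq_true, zero_pow, add_zero]
  have : (0 : ℝ) ≤ T := Nat.cast_nonneg T
  linarith

lemma mul_sqrt_two_mul_le (x : ℝ) : 28 * √(2 * x) ≤ 50 * √x := by
  rw [Real.sqrt_mul zero_le_two]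
  have h : √2 ≤ 3 / 2 := by rw [Real.sqrt_le_left (by norm_num)]; norm_num
  nlinarith [mul_le_mul_of_nonneg_right h (Real.sqrt_nonneg x), Real.sqrt_nonneg x]

end Exp3LBP

theorem mainTheorem2 :
    ∃ C : ℝ, 0 < C ∧
      ∀ (N : ℕ) [NeZero N] (T : ℕ) (δ : ℝ), 0 < δ → δ < 1 →
        -- the three general bounds
        (∀ (l lam : ℕ → Fin N → ℝ) (Q : ℝ),
          (∀ t < T, ∀ i, lam t i ≤ l t i) → 0 < Q → lbVariation T l lam ≤ Q →
          (∀ β : ℝ, β = √(2 / Q * Real.log ((N + 3) / δ)) →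
            (∀ t < T, ∀ i, β * (l t i - lam t i) ≤ 1) →
            Exp3LBP.RegretBound (√(4 / Q * Real.log N)) β T l lam δ
              (C * √(Q * Real.log (N / δ)))) ∧
          Exp3LBP.RegretBound (√(4 / Q * Real.log N)) (√(2 / Q)) T l lam δ
              (C * (√Q * Real.log (N / δ))) ∧
          ((∀ t < T, ∀ i, 0 ≤ lam t i ∧ l t i ≤ 1) → 2 * T ≤ Q →
            Exp3LBP.RegretBound (√(4 / Q * Real.log N))
              (min 1 (√(2 / Q * Real.log ((N + 3) / δ)))) T l lam δ
              (C * √(Q * Real.log (N / δ))))) ∧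
        -- the zeroth-order bounds: bandit setting (`λ = 0`, `Q = 2NT`) and
        -- full-information setting (`λ = l`, `Q = 2T`)
        (∀ l : ℕ → Fin N → ℝ, 1 ≤ T → (∀ t < T, ∀ i, 0 ≤ l t i ∧ l t i ≤ 1) →
          Exp3LBP.RegretBound (√(4 / (2 * N * T) * Real.log N))
            (min 1 (√(2 / (2 * N * T) * Real.log ((N + 3) / δ)))) T l (fun _ _ => 0) δ
            (C * √(N * T * Real.log (N / δ))) ∧
          Exp3LBP.RegretBound (√(4 / (2 * T) * Real.log N))
            (min 1 (√(2 / (2 * T) * Real.log ((N + 3) / δ)))) T l l δ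
            (C * √(T * Real.log (N / δ)))) := by
  refine ⟨50, by norm_num, fun N _ T δ hδ hδ1 => ⟨fun l lam Q hle hQ0 hQ => ⟨?_, ?_, ?_⟩,
    fun l hT hl => ⟨?_, ?_⟩⟩⟩
  · rintro β rfl hβs
    exact (Exp3LBP.regretBound_tuned hδ hδ1 hQ0 hle hQ hβs).mono (by gcongr; norm_num)
  · exact Exp3LBP.regretBound_untuned hδ hδ1 hQ0 hle hQ
  · intro hl hTQ
    exact (Exp3LBP.regretBound_truncated hδ hδ1 hQ0 hle hQ hl hTQ).mono (by gcongr; norm_num)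
  · have hT' : (1 : ℝ) ≤ T := by exact_mod_cast hT
    have hN' : (1 : ℝ) ≤ N := by exact_mod_cast NeZero.pos N
    refine (Exp3LBP.regretBound_truncated (Q := 2 * N * T) hδ hδ1 (by positivity)
      (fun t ht i => (hl t ht i).1) (Exp3LBP.lbVariation_zero_le hl)
      (fun t ht i => ⟨le_rfl, (hl t ht i).2⟩) (by nlinarith)).mono ?_
    rw [mul_assoc 2, mul_assoc 2]
    exact Exp3LBP.mul_sqrt_two_mul_le _
  · have hT' : (1 : ℝ) ≤ T := by exact_mod_cast hT
    refine (Exp3LBP.regretBound_truncated (Q := 2 * T) hδ hδ1 (by positivity)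
      (fun t ht i => le_rfl) (Exp3LBP.lbVariation_self_le hl) hl le_rfl).mono ?_
    rw [mul_assoc 2]
    exact Exp3LBP.mul_sqrt_two_mul_le _
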